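/- Let $A,B$ be finite-dimensional quantum systems of dimensions $d_A,d_B$, and let $a,b$ be qubits. A linear map $\Lambda$ from operators on $AB$ to operators on $ab$ is called *$k$-extendible on Bob's site* if it is completely positive (not necessarily trace-preserving) and its Choi–Jamiołkowski operator $\sigma_{(Aa)(Bb)}=(\mathrm{id}\otimes\Lambda)(\Phi^+_{A'A}\otimes\Phi^+_{B'B})$ (with $A',B'$ renamed $A,B$) has a positive semidefinite extension $\tau$ on $(Aa)(B_0b_0)\cdots(B_kb_k)$ all of whose reductions to $(Aa)(B_ib_i)$, $0\le i\le k$, are equal to $\sigma$; it is *$k$-extendible on Alice's site* if the same holds with the roles of the two parties exchanged. Here $\Phi^+=|\phi_+\rangle\langle\phi_+|$ with $|\phi_+\rangle=\frac1{\sqrt d}\sum_{i}|ii\rangle$. When $\operatorname{tr}\Lambda(\rho)>0$, the fidelity is $F(\rho,\Lambda)=\operatorname{tr}(\Lambda(\rho)\,\Phi^+)/\operatorname{tr}\Lambda(\rho)$ (with $\Phi^+$ on the two qubits $ab$). Say that $\rho_{AB}$ is *distilled on a given site* if for every $k\ge 0$ and every $\alpha<1$ there is an $N$ such that for all $n\ge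 N$ and all $F\in[0,\alpha]$ there is a map $\Lambda$, $k$-extendible on that site, acting on $\rho_{AB}^{\otimes n}$ (with respect to the cut $A^n:B^n$), with $\operatorname{tr}\Lambda(\rho^{\otimes n})>0$ and $F(\rho^{\otimes n},\Lambda)=F$ (in particular, fidelity $\alpha$ is reached if $\alpha\ge 0$). **Theorem.** Let $\rho_{AB}$ be a state. 1. If $\rho_{AB}$ is not the maximally mixed state $I/(d_Ad_B)$, then $\rho_{AB}$ is distilled on Bob's site or on Alice's site (the site depends only on $\rho_{AB}$, not on $k$, $\alpha$ or $n$). 2. If $\rho_{AB}$ is not of the form $\omega_A\otimes I_B$, then $\rho_{AB}$ is distilled on Bob's site. 3. If $\rho_{AB}$ is not of the form $I_A\otimes\omega_B$, then $\rho_{AB}$ is distilled on Alice's site. -/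

import Mathlib

open scoped Kronecker ComplexOrder

noncomputable section

namespace ExtendibleMaps

/-- A (normalized) quantum state, as a density matrix. -/
def IsState {I : Type*} [Fintype I] (ρ : Matrix I I ℂ) : Prop :=
  ρ.PosSemidef ∧ ρ.trace = 1

/-- The maximally mixed state `I / d`. -/
def maximallyMixed (I : Type*) [Fintype I] [DecidableEq I] : Matrix I I ℂ :=
  (Fintype.card I : ℂ)⁻¹ • (1 : Matrix I I ℂ)

/-- The unit vector `(1 / √d) ∑ i, |i i⟩`. -/
def maxEntangledVec (I : Type*) [Fintype I] [DecidableEq I] : I × I → ℂ :=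
  fun x => if x.1 = x.2 then (((Real.sqrt (Fintype.card I))⁻¹ : ℝ) : ℂ) else 0

/-- The maximally entangled state `Φ⁺ = |φ₊⟩⟨φ₊|`. -/
def maxEntangled (I : Type*) [Fintype I] [DecidableEq I] : Matrix (I × I) (I × I) ℂ :=
  Matrix.vecMulVec (maxEntangledVec I) (star (maxEntangledVec I))

/-- `ρ^{⊗ n}` for a bipartite matrix `ρ_{AB}`, as a bipartite matrix on `Aⁿ : Bⁿ`
(Alice holds all the systems `A`, Bob all the systems `B`). -/
def copies {A B : Type*} (n : ℕ) (ρ : Matrix (A × B) (A × B) ℂ) :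
    Matrix ((Fin n → A) × (Fin n → B)) ((Fin n → A) × (Fin n → B)) ℂ :=
  fun x y => ∏ j, ρ (x.1 j, x.2 j) (y.1 j, y.2 j)

/-- `id_R ⊗ Λ`. -/
def idTensor {I J : Type*} (R : Type*) (L : Matrix I I ℂ →ₗ[ℂ] Matrix J J ℂ)
    (X : Matrix (R × I) (R × I) ℂ) : Matrix (R × J) (R × J) ℂ :=
  fun x y => L (fun i i' => X (x.1, i) (y.1, i')) x.2 y.2

/-- Complete positivity: `id_m ⊗ Λ` preserves positive semidefiniteness for every `m`. -/
def IsCompletelyPositive {I J : Type*} (L : Matrix I I ℂ →ₗ[ℂ] Matrix J J ℂ) : Prop :=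
  ∀ (m : ℕ) (X : Matrix (Fin m × I) (Fin m × I) ℂ),
    X.PosSemidef → (idTensor (Fin m) L X).PosSemidef

/-- The Choi-Jamiolkowski operator `(id_{A'B'} ⊗ Λ) (Φ⁺_{A'A} ⊗ Φ⁺_{B'B})` of a map `Λ` from
operators on `AB` to operators on `ab`, written as a bipartite operator on `A'a : B'b`. -/
def choi {A B a b : Type*} [Fintype A] [DecidableEq A] [Fintype B] [DecidableEq B]
    (L : Matrix (A × B) (A × B) ℂ →ₗ[ℂ] Matrix (a × b) (a × b) ℂ) :
    Matrix ((A × a) × (B × b)) ((A × a) × (B × b)) ℂ :=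
  (idTensor (A × B) L
    ((maxEntangled A ⊗ₖ maxEntangled B).submatrix
      (Equiv.prodProdProdComm A B A B) (Equiv.prodProdProdComm A B A B))).submatrix
    (Equiv.prodProdProdComm A a B b) (Equiv.prodProdProdComm A a B b)

/-- The reduction to `P Q_i` (partial trace over all `Q_j` with `j ≠ i`) of an operator on
`P Q_0 … Q_k`. -/
def reduction {P Q : Type*} [Fintype Q] (k : ℕ) (i : Fin (k + 1))
    (τ : Matrix (P × (Fin (k + 1) → Q)) (P × (Fin (k + 1) → Q)) ℂ) :
    Matrix (P × Q) (P × Q) ℂ :=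
  fun x y => ∑ r : Fin k → Q,
    τ (x.1, i.insertNth (α := fun _ => Q) x.2 r) (y.1, i.insertNth (α := fun _ => Q) y.2 r)

/-- The bipartite operator `σ_{PQ}` is `k`-extendible on the site `Q`: some positive semidefinite
operator on `P Q_0 … Q_k` has all its reductions to `P Q_i`, `0 ≤ i ≤ k`, equal to `σ`.
No normalization is imposed; the trace of the extension is that of `σ`. -/
def IsExtendible {P Q : Type*} [Fintype Q] (k : ℕ) (σ : Matrix (P × Q) (P × Q) ℂ) : Prop :=
  ∃ τ : Matrix (P × (Fin (k + 1) → Q)) (P × (Fin (k + 1) → Q)) ℂ,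
    τ.PosSemidef ∧ ∀ i : Fin (k + 1), reduction k i τ = σ

/-- The two parties. -/
inductive Site
  | alice
  | bob

/-- `k`-extendibility of a bipartite operator on Alice's (first) or on Bob's (second) site. -/
def IsExtendibleOn {P Q : Type*} [Fintype P] [Fintype Q] (s : Site) (k : ℕ)
    (σ : Matrix (P × Q) (P × Q) ℂ) : Prop :=
  match s with
  | Site.bob => IsExtendible k σ
  | Site.alice => IsExtendible k (σ.submatrix (Prod.swap : Q × P → P × Q) Prod.swap)

/-- A completely positive (not necessarily trace-preserving) map from operators on `AB` to
operators on `ab` is `k`-extendible on the site `s` if its Choi-Jamiolkowski operator is, with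
respect to the cut `Aa : Bb`. -/
def IsExtendibleMap {A B a b : Type*} [Fintype A] [DecidableEq A] [Fintype B] [DecidableEq B]
    [Fintype a] [Fintype b] (s : Site) (k : ℕ)
    (L : Matrix (A × B) (A × B) ℂ →ₗ[ℂ] Matrix (a × b) (a × b) ℂ) : Prop :=
  IsCompletelyPositive L ∧ IsExtendibleOn s k (choi L)

/-- The fidelity `F(ρ, Λ) = tr (Λ(ρ) Φ⁺) / tr (Λ(ρ))`, meaningful when `tr (Λ(ρ)) > 0`. -/
def fidelity {I c : Type*} [Fintype c] [DecidableEq c]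
    (ρ : Matrix I I ℂ) (L : Matrix I I ℂ →ₗ[ℂ] Matrix (c × c) (c × c) ℂ) : ℝ :=
  (L ρ * maxEntangled c).trace.re / (L ρ).trace.re

/-- Some map with two-qubit output that is `k`-extendible on the site `s` has nonzero probability
of success on `ρ` and attains the fidelity `F`. -/
def Attains {A B : Type*} [Fintype A] [DecidableEq A] [Fintype B] [DecidableEq B]
    (s : Site) (k : ℕ) (ρ : Matrix (A × B) (A × B) ℂ) (F : ℝ) : Prop :=
  ∃ L : Matrix (A × B) (A × B) ℂ →ₗ[ℂ] Matrix (Fin 2 × Fin 2) (Fin 2 × Fin 2) ℂ,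
    IsExtendibleMap s k L ∧ 0 < (L ρ).trace.re ∧ fidelity ρ L = F

/-- For every `k` and every `α < 1`, from all sufficiently large numbers of copies of `ρ`, the maps
that are `k`-extendible on the site `s` attain every fidelity in `[0, α]`. -/
def Distills {A B : Type*} [Fintype A] [DecidableEq A] [Fintype B] [DecidableEq B]
    (s : Site) (ρ : Matrix (A × B) (A × B) ℂ) : Prop :=
  ∀ (k : ℕ) (α : ℝ), α < 1 → ∃ N : ℕ, ∀ n ≥ N, ∀ F : ℝ, 0 ≤ F → F ≤ α →
    Attains s k (copies n ρ) F

end ExtendibleMaps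

end

noncomputable section

namespace ExtendibleMaps

open Matrix Finset

/-! If `ρ` is not `ω ⊗ I`, some product vectors `u ⊗ v`, `u ⊗ w` with `v`, `w` unit have
expectations `p > q` in `ρ` (`exists_eq_kronecker_one`). On `n` copies their tensor powers have
weights `p ^ n`, `q ^ n`, whose ratio diverges.

An operator `G` on `PQ` becomes `k`-extendible once `k G_P ⊗ H` is added, `H` any state
(`isExtendible_add`). With `G` the Choi operator of "find `u ⊗ v`, prepare `S`" and `H` flagged by
`w`, the added noise is triggered only by `u ⊗ w` (`isExtendibleMap_flagMap`). Its weight relative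
to the signal is `k (q / p) ^ n`, which tends to 0, so fidelities approach 1. Exchanging the parties
gives Alice's site; only the maximally mixed state has both exceptional forms. -/

/-! ### Extendible operators by symmetrization -/

/-- An entrywise product of positive semidefinite matrices is positive semidefinite. -/
theorem posSemidef_prod {ι I : Type*} [Finite I] (s : Finset ι) (M : ι → Matrix I I ℂ)
    (hM : ∀ i, (M i).PosSemidef) :
    (Matrix.of fun x y => ∏ i ∈ s, M i x y : Matrix I I ℂ).PosSemidef := by
  classical
  induction s using Finset.induction_on with
  | empty =>
    have h : (Matrix.of fun x y => ∏ i ∈ ∅, M i x y : Matrix I I ℂ) =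
        vecMulVec (fun _ => 1) (star fun _ => 1) := by
      ext x y
      simp [vecMulVec_apply]
    rw [h]
    exact posSemidef_vecMulVec_self_star _
  | insert i s hi ih =>
    have h : (Matrix.of fun x y => ∏ j ∈ insert i s, M j x y : Matrix I I ℂ) =
        M i ⊙ Matrix.of fun x y => ∏ j ∈ s, M j x y := by
      ext x y
      simp [Finset.prod_insert hi]
    rw [h]
    exact (hM i).hadamard ih

/-- Replacing `Q` in `G` by a fresh copy of `H` and averaging over the `k + 1` possible positions
of `G` gives an extendible operator. -/
theorem isExtendible_add {P Q : Type*} [Finite P] [Fintype Q] (k : ℕ) (G : Matrix (P × Q) (P × Q) ℂ)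
    (H : Matrix Q Q ℂ) (hG : G.PosSemidef) (hH : H.PosSemidef) (htr : H.trace = 1) :
    IsExtendible k (Matrix.of fun x y =>
      G x y + k * ((∑ q, G (x.1, q) (y.1, q)) * H x.2 y.2)) := by
  classical
  refine ⟨∑ i, Matrix.of fun x y => ∏ l, if l = i then G (x.1, x.2 l) (y.1, y.2 l)
    else H (x.2 l) (y.2 l), Matrix.posSemidef_sum _ fun i _ => ?_, fun j => ?_⟩
  · convert posSemidef_prod univ (fun l => if l = i then
      G.submatrix (fun x : P × (Fin (k + 1) → Q) => (x.1, x.2 l)) (fun x => (x.1, x.2 l)) else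
      H.submatrix (fun x : P × (Fin (k + 1) → Q) => x.2 l) (fun x => x.2 l)) ?_ using 1
    · ext x y
      simp only [of_apply]
      refine Finset.prod_congr rfl fun l _ => ?_
      split_ifs <;> rfl
    · intro l
      split_ifs
      · exact hG.submatrix _
      · exact hH.submatrix _
  · have htr' : ∑ q, H q q = 1 := htr
    ext ⟨p, q⟩ ⟨p', q'⟩
    simp only [reduction, Matrix.sum_apply, of_apply]
    -- The term with `G` at site `j` reduces to `G`, since every `H` has trace 1; in each of the
    -- other `k` terms `G` loses its `Q` and site `j` holds `H`.
    rw [Finset.sum_comm, Fin.sum_univ_succAbove _ j]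
    congr 1
    · simp [Fin.prod_univ_succAbove _ j, Fin.succAbove_ne, ← Finset.mul_sum,
        ← Fintype.prod_sum (fun (_ : Fin k) (t : Q) => H t t), htr']
    · have key : ∀ i : Fin k, (∑ r : Fin k → Q, ∏ l : Fin (k + 1),
          if l = j.succAbove i then
            G (p, (j.insertNth (α := fun _ => Q) q r) l)
              (p', (j.insertNth (α := fun _ => Q) q' r) l)
          else H ((j.insertNth (α := fun _ => Q) q r) l)
            ((j.insertNth (α := fun _ => Q) q' r) l)) =
          (∑ t, G (p, t) (p', t)) * H q q' := by
        intro i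
        simp only [Fin.prod_univ_succAbove _ j, Fin.insertNth_apply_same,
          Fin.insertNth_apply_succAbove, (Fin.succAbove_ne j i).symm, if_false,
          Fin.succAbove_right_inj, ← Finset.mul_sum]
        rw [← Fintype.prod_sum (fun (l : Fin k) (t : Q) =>
          if l = i then G (p, t) (p', t) else H t t), mul_comm]
        congr 1
        rw [Finset.prod_eq_single i]
        · simp
        · intro l _ hl
          simpa [hl] using htr'
        · simp
      simp [key]

/-! ### Measure-and-prepare maps and their Choi operators -/

/-- The quantum operation `X ↦ ⟨ψ|X|ψ⟩ S`. -/
def measurePrepare {I J : Type*} [Fintype I] (ψ : I → ℂ) (S : Matrix J J ℂ) :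
    Matrix I I ℂ →ₗ[ℂ] Matrix J J ℂ where
  toFun X := (star ψ ⬝ᵥ X *ᵥ ψ) • S
  map_add' X Y := by simp [add_mulVec, dotProduct_add, add_smul]
  map_smul' c X := by simp [smul_mulVec, dotProduct_smul, mul_smul]

theorem isCompletelyPositive_measurePrepare {I J : Type*} [Fintype I] [Fintype J] (ψ : I → ℂ)
    {S : Matrix J J ℂ} (hS : S.PosSemidef) : IsCompletelyPositive (measurePrepare ψ S) := by
  intro m X hX
  -- Conjugation by `1 ⊗ |ψ⟩` implements `id ⊗ ⟨ψ|·|ψ⟩`.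
  have hK : (_ ⊗ₖ S).PosSemidef := PosSemidef.kronecker (hX.conjTranspose_mul_mul_same (Matrix.of fun (z : Fin m × I) (y : Fin m) =>
    if z.1 = y then ψ z.2 else 0)) hS
  refine Eq.mp (congrArg _ ?_) hK
  ext ⟨x, j⟩ ⟨y, j'⟩
  simp only [idTensor, measurePrepare, LinearMap.coe_mk, AddHom.coe_mk, Matrix.smul_apply, smul_eq_mul,
    kroneckerMap_apply]
  congr 1
  simp only [dotProduct, mulVec, mul_apply, conjTranspose_apply, of_apply, Fintype.sum_prod_type,
    Pi.star_apply, apply_ite (star : ℂ → ℂ), star_zero, ite_mul, zero_mul, mul_ite, mul_zero]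
  simp [Finset.mul_sum, Finset.sum_mul]
  rw [Finset.sum_comm]
  simp [mul_assoc]

theorem IsCompletelyPositive.add {I J : Type*} {L M : Matrix I I ℂ →ₗ[ℂ] Matrix J J ℂ}
    (hL : IsCompletelyPositive L) (hM : IsCompletelyPositive M) : IsCompletelyPositive (L + M) :=
  fun m X hX => (hL m X hX).add (hM m X hX)

/-- The normalization factor `1 / (d_A d_B)` of the Choi operator. -/
def choiScale (A B : Type*) [Fintype A] [Fintype B] : ℝ :=
  ((Real.sqrt (Fintype.card A))⁻¹ * (Real.sqrt (Fintype.card B))⁻¹) ^ 2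

theorem choi_measurePrepare_apply {A B a b : Type*} [Fintype A] [DecidableEq A] [Fintype B]
    [DecidableEq B] (ψ : A × B → ℂ) (S : Matrix (a × b) (a × b) ℂ)
    (x y : (A × a) × (B × b)) :
    choi (measurePrepare ψ S) x y = choiScale A B *
      (star (ψ (x.1.1, x.2.1)) * ψ (y.1.1, y.2.1)) * S (x.1.2, x.2.2) (y.1.2, y.2.2) := by
  obtain ⟨⟨x1, x2⟩, ⟨x3, x4⟩⟩ := x
  obtain ⟨⟨y1, y2⟩, ⟨y3, y4⟩⟩ := y
  simp only [choi, idTensor, measurePrepare, LinearMap.coe_mk, AddHom.coe_mk, Matrix.smul_apply,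
    smul_eq_mul, submatrix_apply, Equiv.prodProdProdComm_apply, kroneckerMap_apply]
  congr 1
  simp only [dotProduct, mulVec, maxEntangled, vecMulVec_apply, maxEntangledVec, Pi.star_apply,
    Fintype.sum_prod_type]
  simp [choiScale, apply_ite (starRingEnd ℂ), Finset.sum_ite_eq, ite_mul, mul_ite]
  ring

theorem choi_add {A B a b : Type*} [Fintype A] [DecidableEq A] [Fintype B] [DecidableEq B]
    (L M : Matrix (A × B) (A × B) ℂ →ₗ[ℂ] Matrix (a × b) (a × b) ℂ) :
    choi (L + M) = choi L + choi M := rfl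

/-- The product vector `u ⊗ v`. -/
def tensorVec {A B : Type*} (u : A → ℂ) (v : B → ℂ) : A × B → ℂ := fun x => u x.1 * v x.2

/-- If Bob finds `v`, the parties prepare `S`; if he finds `w`, they prepare `k` times the
reduction of `S` to Alice's system tensored with `J`. -/
def flagMap {A B a b : Type*} [Fintype A] [Fintype B] [Fintype b] (k : ℕ) (u : A → ℂ)
    (v w : B → ℂ) (S : Matrix (a × b) (a × b) ℂ) (J : Matrix b b ℂ) :
    Matrix (A × B) (A × B) ℂ →ₗ[ℂ] Matrix (a × b) (a × b) ℂ :=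
  measurePrepare (tensorVec u v) S + measurePrepare (tensorVec u w)
    (Matrix.of fun x y => k * ((∑ q, S (x.1, q) (y.1, q)) * J x.2 y.2))

theorem posSemidef_partialTrace {P Q : Type*} [Fintype Q] {S : Matrix (P × Q) (P × Q) ℂ}
    (hS : S.PosSemidef) : (Matrix.of fun x y => ∑ q, S (x, q) (y, q)).PosSemidef := by
  convert Matrix.posSemidef_sum univ (fun q _ => hS.submatrix (fun x => (x, q))) using 1
  ext x y
  simp [Matrix.sum_apply]

/-- Both branches use the same `u`, and tracing Bob out of the first Choi operator `G` removes the
unit vector `v`. Hence the second branch has Choi operator `k G_P ⊗ H` with `H = |w̄⟩⟨w̄| ⊗ J`, as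
`isExtendible_add` requires. -/
theorem isExtendibleMap_flagMap {A B a b : Type*} [Fintype A] [DecidableEq A] [Fintype B]
    [DecidableEq B] [Fintype a] [Fintype b] (k : ℕ) (u : A → ℂ) (v w : B → ℂ)
    (hv : star v ⬝ᵥ v = 1) (hw : star w ⬝ᵥ w = 1)
    {S : Matrix (a × b) (a × b) ℂ} {J : Matrix b b ℂ} (hS : S.PosSemidef) (hJ : J.PosSemidef)
    (hJ' : J.trace = 1) : IsExtendibleMap Site.bob k (flagMap k u v w S J) := by
  constructor
  · refine (isCompletelyPositive_measurePrepare _ hS).add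
      (isCompletelyPositive_measurePrepare _ ?_)
    have h : (_ ⊗ₖ J).PosSemidef := (posSemidef_partialTrace hS).kronecker hJ
    exact h.smul (Nat.cast_nonneg (α := ℂ) k)
  · have hG : (choi (measurePrepare (tensorVec u v) S)).PosSemidef := by
      have h : (vecMulVec (star (tensorVec u v)) (tensorVec u v) ⊗ₖ S).PosSemidef :=
        (posSemidef_vecMulVec_star_self (tensorVec u v)).kronecker hS
      have h' : (choiScale A B : ℂ) ≥ 0 := by
        rw [ge_iff_le, Complex.zero_le_real]
        exact sq_nonneg _
      refine Eq.mp (congrArg _ ?_) ((h.smul h').submatrix (Equiv.prodProdProdComm A a B b))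
      ext x y
      simp [choi_measurePrepare_apply, vecMulVec_apply, mul_assoc]
    have hH : (vecMulVec (star w) w ⊗ₖ J).PosSemidef :=
      (posSemidef_vecMulVec_star_self w).kronecker hJ
    have htr : (vecMulVec (star w) w ⊗ₖ J).trace = 1 := by
      rw [trace_kronecker, trace_vecMulVec, hw, hJ', mul_one]
    have key := isExtendible_add k _ _ hG hH htr
    show IsExtendible k _
    convert key using 1
    ext x y
    simp only [flagMap, choi_add, Matrix.add_apply, of_apply, choi_measurePrepare_apply, tensorVec,
      kroneckerMap_apply, vecMulVec_apply, Fintype.sum_prod_type, Pi.star_apply, star_mul']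
    congr 1
    have hv' : ∑ q, star (v q) * v q = 1 := hv
    have : ∀ p p' : A × a, (∑ q : B, ∑ r : b, (choiScale A B : ℂ) *
        (star (u p.1) * star (v q) * (u p'.1 * v q)) * S (p.2, r) (p'.2, r)) =
        choiScale A B * (star (u p.1) * u p'.1) * ∑ r, S (p.2, r) (p'.2, r) := by
      intro p p'
      have h1 : (choiScale A B * (star (u p.1) * u p'.1) : ℂ) =
          ∑ q, choiScale A B * (star (u p.1) * u p'.1) * (star (v q) * v q) := by
        rw [← Finset.mul_sum, hv', mul_one]
      rw [h1, Finset.sum_mul]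
      refine Finset.sum_congr rfl fun q _ => ?_
      rw [Finset.mul_sum]
      exact Finset.sum_congr rfl fun r _ => by ring
    rw [this]
    ring


/-! ### Product expectations and the form `ω ⊗ I` -/

/-- A complex matrix is determined by its quadratic form. -/
theorem eq_zero_of_quadraticForm_eq_zero {I : Type*} [Fintype I] [DecidableEq I]
    {T : Matrix I I ℂ} (h : ∀ v : I → ℂ, star v ⬝ᵥ T *ᵥ v = 0) : T = 0 := by
  have h0 : Matrix.toEuclideanLin T = 0 := by
    rw [← inner_map_self_eq_zero]
    intro x
    rw [← inner_conj_symm, EuclideanSpace.inner_eq_star_dotProduct, dotProduct_comm]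
    simpa using h x.ofLp
  simpa using h0

theorem quadraticForm_tensorVec {A B : Type*} [Fintype A] [Fintype B]
    (ρ : Matrix (A × B) (A × B) ℂ) (u : A → ℂ) (v : B → ℂ) :
    star (tensorVec u v) ⬝ᵥ ρ *ᵥ tensorVec u v = star v ⬝ᵥ
      (Matrix.of fun b b' => star u ⬝ᵥ (Matrix.of fun a a' => ρ (a, b) (a', b')) *ᵥ u) *ᵥ v := by
  simp only [dotProduct, mulVec, tensorVec, Fintype.sum_prod_type, Pi.star_apply, of_apply,
    star_mul', Finset.mul_sum, Finset.sum_mul]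
  rw [Finset.sum_comm]
  refine Finset.sum_congr rfl fun b _ => ?_
  conv_rhs => rw [Finset.sum_comm]
  refine Finset.sum_congr rfl fun a _ => ?_
  conv_rhs => rw [Finset.sum_comm]
  exact Finset.sum_congr rfl fun a' _ => Finset.sum_congr rfl fun b' _ => by ring

/-- For fixed `u`, the operator `⟨u|ρ|u⟩` on `B` has a constant form on unit vectors, so it is
scalar. As this holds for all `u`, each block of `ρ` is determined by its form in `u`. -/
theorem exists_eq_kronecker_one {A B : Type*} [Fintype A] [DecidableEq A] [Fintype B]
    [DecidableEq B] (ρ : Matrix (A × B) (A × B) ℂ)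
    (h : ∀ (u : A → ℂ) (v w : B → ℂ), star v ⬝ᵥ v = 1 → star w ⬝ᵥ w = 1 →
      star (tensorVec u v) ⬝ᵥ ρ *ᵥ tensorVec u v =
        star (tensorVec u w) ⬝ᵥ ρ *ᵥ tensorVec u w) :
    ∃ ω : Matrix A A ℂ, ρ = ω ⊗ₖ (1 : Matrix B B ℂ) := by
  rcases isEmpty_or_nonempty B with hB | ⟨⟨b₀⟩⟩
  · exact ⟨0, by ext ⟨a, b⟩; exact hB.elim b⟩
  refine ⟨Matrix.of fun a a' => ρ (a, b₀) (a', b₀), ?_⟩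
  set R : B → B → Matrix A A ℂ := fun b b' => Matrix.of fun a a' => ρ (a, b) (a', b') with hR
  have hT : ∀ u : A → ℂ, (Matrix.of fun b b' => star u ⬝ᵥ R b b' *ᵥ u) -
      (star u ⬝ᵥ R b₀ b₀ *ᵥ u) • (1 : Matrix B B ℂ) = 0 := by
    intro u
    refine eq_zero_of_quadraticForm_eq_zero fun v => ?_
    rw [sub_mulVec, dotProduct_sub, smul_mulVec, one_mulVec, dotProduct_smul, sub_eq_zero]
    rcases eq_or_ne v 0 with rfl | hv
    · simp
    have hpos : 0 < star v ⬝ᵥ v := dotProduct_star_self_pos_iff.mpr hv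
    -- The hypothesis covers unit vectors only, so `v` is divided by its norm `s` and compared with
    -- the basis vector at `b₀`.
    obtain ⟨s, hs0, hs⟩ : ∃ s : ℝ, 0 < s ∧ star v ⬝ᵥ v = ((s ^ 2 : ℝ) : ℂ) := by
      obtain ⟨t, ht⟩ : ∃ t : ℝ, star v ⬝ᵥ v = t :=
        ⟨_, (Complex.eq_re_of_ofReal_le hpos.le)⟩
      have ht0 : 0 < t := by rw [ht] at hpos; exact_mod_cast hpos
      exact ⟨√t, Real.sqrt_pos.mpr ht0, by rw [ht, Real.sq_sqrt ht0.le]⟩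
    have hsC : (s : ℂ) ≠ 0 := by exact_mod_cast hs0.ne'
    have key := h u ((s : ℂ)⁻¹ • v) (Pi.single b₀ 1) (by
      simp [hs]; field_simp) (by simp)
    rw [quadraticForm_tensorVec, quadraticForm_tensorVec] at key
    simp [mulVec_smul] at key
    rw [hs]
    push_cast
    field_simp at key
    rw [smul_eq_mul, mul_comm]
    exact key
  ext ⟨a, b⟩ ⟨a', b'⟩
  have hN : R b b' - (1 : Matrix B B ℂ) b b' • R b₀ b₀ = 0 := by
    refine eq_zero_of_quadraticForm_eq_zero fun u => ?_
    have := congrFun (congrFun (hT u) b) b'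
    simp only [Matrix.sub_apply, of_apply, Matrix.smul_apply, smul_eq_mul, Matrix.zero_apply] at this
    rw [sub_mulVec, dotProduct_sub, smul_mulVec, dotProduct_smul, smul_eq_mul, mul_comm, this]
  have := congrFun (congrFun hN a) a'
  simp only [Matrix.sub_apply, Matrix.smul_apply, Matrix.zero_apply, hR, of_apply, sub_eq_zero] at this
  rw [this, kroneckerMap_apply, of_apply, smul_eq_mul, mul_comm]

/-! ### Tensor powers -/

/-- The tensor power of a vector. -/
def tensorPow {I : Type*} (n : ℕ) (v : I → ℂ) : (Fin n → I) → ℂ := fun f => ∏ j, v (f j)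

theorem star_tensorPow_dotProduct {I : Type*} [Fintype I] (n : ℕ) (v : I → ℂ)
    (hv : star v ⬝ᵥ v = 1) : star (tensorPow n v) ⬝ᵥ tensorPow n v = 1 := by
  rw [← one_pow n, ← hv, dotProduct, dotProduct, Fintype.sum_pow]
  simp [tensorPow, Finset.prod_mul_distrib]

theorem quadraticForm_copies {A B : Type*} [Fintype A] [Fintype B] (n : ℕ)
    (ρ : Matrix (A × B) (A × B) ℂ) (u : A → ℂ) (v : B → ℂ) :
    star (tensorVec (tensorPow n u) (tensorPow n v)) ⬝ᵥ copies n ρ *ᵥ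
      tensorVec (tensorPow n u) (tensorPow n v) =
      (star (tensorVec u v) ⬝ᵥ ρ *ᵥ tensorVec u v) ^ n := by
  have h1 : ∀ (I : Type _) [Fintype I] (X : Matrix I I ℂ) (ψ : I → ℂ), star ψ ⬝ᵥ X *ᵥ ψ =
      ∑ z : I × I, star (ψ z.1) * (X z.1 z.2 * ψ z.2) := by
    intro I _ X ψ
    simp only [dotProduct, mulVec, Fintype.sum_prod_type, Pi.star_apply, Finset.mul_sum]
  rw [h1, h1, Fintype.sum_pow]
  refine (Fintype.sum_equiv ((Equiv.arrowProdEquivProdArrow _ _ _).trans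
    (Equiv.prodCongr (Equiv.arrowProdEquivProdArrow _ _ _)
      (Equiv.arrowProdEquivProdArrow _ _ _))) _ _ fun f => ?_).symm
  simp [tensorVec, tensorPow, copies, Finset.prod_mul_distrib]


/-! ### Attaining a prescribed fidelity -/

/-- The unnormalized two-qubit operator `x Φ⁺ + y |01⟩⟨01|`. -/
def targetState (x y : ℝ) : Matrix (Fin 2 × Fin 2) (Fin 2 × Fin 2) ℂ :=
  (x : ℂ) • maxEntangled (Fin 2) +
    (y : ℂ) • vecMulVec (Pi.single (0, 1) 1) (star (Pi.single (0, 1) 1))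

/-- The qubit state `|1⟩⟨1|`. -/
def flagState : Matrix (Fin 2) (Fin 2) ℂ := vecMulVec (Pi.single 1 1) (star (Pi.single 1 1))

theorem posSemidef_targetState {x y : ℝ} (hx : 0 ≤ x) (hy : 0 ≤ y) :
    (targetState x y).PosSemidef :=
  ((posSemidef_vecMulVec_self_star _).smul (Complex.zero_le_real.mpr hx)).add
    ((posSemidef_vecMulVec_self_star _).smul (Complex.zero_le_real.mpr hy))

theorem trace_flagState : flagState.trace = 1 := by
  simp [flagState, trace_vecMulVec]

theorem sq_maxEntangledVec_two : (((√2)⁻¹ : ℝ) : ℂ) * (((√2)⁻¹ : ℝ) : ℂ) = 1 / 2 := by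
  rw [← Complex.ofReal_mul, ← mul_inv, Real.mul_self_sqrt (by norm_num)]
  norm_num

theorem maxEntangled_two_apply (i j i' j' : Fin 2) :
    maxEntangled (Fin 2) (i, j) (i', j') = if i = j ∧ i' = j' then 1 / 2 else 0 := by
  rw [← sq_maxEntangledVec_two]
  by_cases h : i = j <;> by_cases h' : i' = j' <;>
    simp [maxEntangled, maxEntangledVec, vecMulVec_apply, h, h']

theorem trace_targetState (x y : ℝ) : (targetState x y).trace = ((x + y : ℝ) : ℂ) := by
  simp [targetState, Matrix.trace, Fintype.sum_prod_type, maxEntangled_two_apply, vecMulVec_apply,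
    Pi.single_apply]
  ring

theorem trace_targetState_mul (x y : ℝ) :
    (targetState x y * maxEntangled (Fin 2)).trace = (x : ℂ) := by
  simp [targetState, Matrix.trace, Fintype.sum_prod_type, maxEntangled_two_apply, vecMulVec_apply,
    Pi.single_apply, mul_apply]
  ring

/-- `Φ⁺` reduces to `I / 2`, and `I / 2 ⊗ |1⟩⟨1|` overlaps `Φ⁺` by 1/4; `|01⟩⟨01|` reduces to
`|0⟩⟨0|`, which next to the flag `|1⟩` contributes nothing. -/
theorem trace_partialTrace_mul (k : ℕ) (x y : ℝ) :
    (((Matrix.of fun i j => k * ((∑ q, targetState x y (i.1, q) (j.1, q)) * flagState i.2 j.2)) :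
      Matrix (Fin 2 × Fin 2) (Fin 2 × Fin 2) ℂ) * maxEntangled (Fin 2)).trace =
      ((k * (x / 4) : ℝ) : ℂ) := by
  simp [targetState, flagState, Matrix.trace, Fintype.sum_prod_type, maxEntangled_two_apply,
    vecMulVec_apply, Pi.single_apply, mul_apply]
  ring

theorem trace_partialTrace {a b : Type*} [Fintype a] [Fintype b] (k : ℕ)
    (S : Matrix (a × b) (a × b) ℂ) (J : Matrix b b ℂ) (hJ : J.trace = 1) :
    (Matrix.of fun i j => k * ((∑ q, S (i.1, q) (j.1, q)) * J i.2 j.2) :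
      Matrix (a × b) (a × b) ℂ).trace = k * S.trace := by
  have hJ' : ∑ q, J q q = 1 := hJ
  simp [Matrix.trace, Fintype.sum_prod_type, ← Finset.mul_sum, hJ']

/-- If the two outcomes occur with weights `P` and `Q`, every fidelity up to
`(P + k Q / 4) / (P + k Q)` is attained. -/
theorem attains_of_weights {A B : Type*} [Fintype A] [DecidableEq A] [Fintype B] [DecidableEq B]
    (k : ℕ) (ρ : Matrix (A × B) (A × B) ℂ) (u : A → ℂ) (v w : B → ℂ)
    (hv : star v ⬝ᵥ v = 1) (hw : star w ⬝ᵥ w = 1) {P Q F : ℝ} (hP : 0 < P) (hQ : 0 ≤ Q)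
    (hvP : star (tensorVec u v) ⬝ᵥ ρ *ᵥ tensorVec u v = P)
    (hwQ : star (tensorVec u w) ⬝ᵥ ρ *ᵥ tensorVec u w = Q)
    (hF : 0 ≤ F) (hF' : F ≤ (P + k * Q / 4) / (P + k * Q)) : Attains Site.bob k ρ F := by
  -- Giving `S` trace `m` makes the output trace `(P + k Q) m = P + k Q / 4`. The overlap is `(P + k
  -- Q / 4) F`, so the fidelity is exactly `F`; positivity of `S` needs `F ≤ m`.
  set m := (P + k * Q / 4) / (P + k * Q) with hm
  have hPQ : 0 < P + k * Q := by positivity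
  have hPQ' : 0 < P + k * Q / 4 := by positivity
  have hm0 : 0 < m := by positivity
  have htr : (flagMap k u v w (targetState F (m - F)) flagState ρ).trace =
      (((P + k * Q) * m : ℝ) : ℂ) := by
    simp only [flagMap, measurePrepare, LinearMap.add_apply, LinearMap.coe_mk, AddHom.coe_mk,
      trace_add, trace_smul, trace_partialTrace _ _ _ trace_flagState, trace_targetState, hvP, hwQ,
      smul_eq_mul]
    push_cast
    ring
  have hov : (flagMap k u v w (targetState F (m - F)) flagState ρ * maxEntangled (Fin 2)).trace =
      (((P + k * Q / 4) * F : ℝ) : ℂ) := by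
    simp only [flagMap, measurePrepare, LinearMap.add_apply, LinearMap.coe_mk, AddHom.coe_mk,
      add_mul, smul_mul, trace_add, trace_smul, trace_partialTrace_mul, trace_targetState_mul, hvP,
      hwQ, smul_eq_mul]
    push_cast
    ring
  refine ⟨flagMap k u v w (targetState F (m - F)) flagState,
    isExtendibleMap_flagMap k u v w hv hw (posSemidef_targetState hF (sub_nonneg.mpr hF'))
      (posSemidef_vecMulVec_self_star _) trace_flagState, ?_, ?_⟩
  · rw [htr, Complex.ofReal_re]
    positivity
  · rw [fidelity, htr, hov, Complex.ofReal_re, Complex.ofReal_re, hm]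
    field_simp

/-! ### Distillation on Bob's site -/

theorem eventually_le_fidelityBound (k : ℕ) {p q α : ℝ} (hq : 0 ≤ q) (hqp : q < p) (hα : α < 1) :
    ∀ᶠ n : ℕ in Filter.atTop, α ≤ (p ^ n + k * q ^ n / 4) / (p ^ n + k * q ^ n) := by
  have hp : 0 < p := hq.trans_lt hqp
  have h0 : Filter.Tendsto (fun n : ℕ => (q / p) ^ n) Filter.atTop (nhds 0) :=
    tendsto_pow_atTop_nhds_zero_of_lt_one (by positivity) ((div_lt_one hp).mpr hqp)
  have h1 : Filter.Tendsto (fun n : ℕ => (1 + k * (q / p) ^ n / 4) / (1 + k * (q / p) ^ n))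
      Filter.atTop (nhds ((1 + k * 0 / 4) / (1 + k * 0))) :=
    (((h0.const_mul _).div_const _).const_add _).div ((h0.const_mul _).const_add _) (by simp)
  filter_upwards [h1.eventually_const_le (u := α) (by simpa using hα)] with n hn
  refine hn.trans_eq ?_
  rw [div_pow]
  have : 0 < p ^ n := by positivity
  field_simp

theorem distills_bob {A B : Type*} [Fintype A] [DecidableEq A] [Fintype B] [DecidableEq B]
    (ρ : Matrix (A × B) (A × B) ℂ) (hρ : ρ.PosSemidef)
    (h : ¬ ∃ ω : Matrix A A ℂ, ρ = ω ⊗ₖ (1 : Matrix B B ℂ)) : Distills Site.bob ρ := by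
  have hform : ∀ ψ, ∃ r : ℝ, 0 ≤ r ∧ star ψ ⬝ᵥ ρ *ᵥ ψ = r := fun ψ => by
    have h0 := hρ.dotProduct_mulVec_nonneg ψ
    exact ⟨_, (Complex.nonneg_iff.mp h0).1, Complex.eq_re_of_ofReal_le h0⟩
  choose f hf0 hf using hform
  obtain ⟨u, v, w, hv, hw, hlt⟩ : ∃ (u : A → ℂ) (v w : B → ℂ), star v ⬝ᵥ v = 1 ∧
      star w ⬝ᵥ w = 1 ∧ f (tensorVec u w) < f (tensorVec u v) := by
    -- Without a strict inequality, exchanging `v` and `w` gives equality for all unit vectors.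
    by_contra! hcon
    refine h (exists_eq_kronecker_one ρ fun u v w hv hw => ?_)
    rw [hf, hf, (hcon u v w hv hw).antisymm (hcon u w v hw hv)]
  intro k α hα
  obtain ⟨N, hN⟩ := Filter.eventually_atTop.mp (eventually_le_fidelityBound k (hf0 _) hlt hα)
  refine ⟨N, fun n hn F hF hFα => ?_⟩
  refine attains_of_weights k _ (tensorPow n u) (tensorPow n v) (tensorPow n w)
    (star_tensorPow_dotProduct n v hv) (star_tensorPow_dotProduct n w hw)
    (pow_pos ((hf0 _).trans_lt hlt) n) (pow_nonneg (hf0 (tensorVec u w)) n) ?_ ?_ hF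
    (hFα.trans (hN n hn))
  · rw [quadraticForm_copies, hf, Complex.ofReal_pow]
  · rw [quadraticForm_copies, hf, Complex.ofReal_pow]

/-! ### Exchange of the parties -/

/-- Conjugation of a map by the exchange of the two parties. -/
def swapMap {A B a b : Type*} (L : Matrix (B × A) (B × A) ℂ →ₗ[ℂ] Matrix (b × a) (b × a) ℂ) :
    Matrix (A × B) (A × B) ℂ →ₗ[ℂ] Matrix (a × b) (a × b) ℂ where
  toFun X := (L (X.submatrix Prod.swap Prod.swap)).submatrix Prod.swap Prod.swap
  map_add' X Y := congrArg (fun Z : Matrix (b × a) (b × a) ℂ => Z.submatrix Prod.swap Prod.swap)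
    (L.map_add (X.submatrix Prod.swap Prod.swap) (Y.submatrix Prod.swap Prod.swap))
  map_smul' c X := congrArg (fun Z : Matrix (b × a) (b × a) ℂ => Z.submatrix Prod.swap Prod.swap)
    (L.map_smul c (X.submatrix Prod.swap Prod.swap))

theorem choi_swapMap {A B a b : Type*} [Fintype A] [DecidableEq A] [Fintype B] [DecidableEq B]
    (L : Matrix (B × A) (B × A) ℂ →ₗ[ℂ] Matrix (b × a) (b × a) ℂ) :
    (choi (swapMap L)).submatrix Prod.swap Prod.swap = choi L := by
  ext ⟨⟨x1, x2⟩, ⟨x3, x4⟩⟩ ⟨⟨y1, y2⟩, ⟨y3, y4⟩⟩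
  refine congrArg (fun Z => L Z (x2, x4) (y2, y4)) ?_
  ext i j
  exact mul_comm (maxEntangled A (x3, i.2) (y3, j.2)) (maxEntangled B (x1, i.1) (y1, j.1))

theorem IsCompletelyPositive.swapMap {A B a b : Type*}
    {L : Matrix (B × A) (B × A) ℂ →ₗ[ℂ] Matrix (b × a) (b × a) ℂ}
    (hL : IsCompletelyPositive L) : IsCompletelyPositive (swapMap L) := fun m X hX =>
  (hL m (X.submatrix (Prod.map id Prod.swap) (Prod.map id Prod.swap)) (hX.submatrix _)).submatrix
    (Prod.map id Prod.swap)

/-- The trace and `Φ⁺` are invariant under the exchange, so the fidelity is too. -/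
theorem Attains.alice_of_swap {A B : Type*} [Fintype A] [DecidableEq A] [Fintype B]
    [DecidableEq B] {k : ℕ} {ρ : Matrix (A × B) (A × B) ℂ} {F : ℝ}
    (h : Attains Site.bob k (ρ.submatrix (Prod.swap : B × A → A × B) Prod.swap) F) :
    Attains Site.alice k ρ F := by
  obtain ⟨L, ⟨hcp, hext⟩, hpos, hfid⟩ := h
  have htr : ∀ X : Matrix (Fin 2 × Fin 2) (Fin 2 × Fin 2) ℂ,
      (X.submatrix Prod.swap Prod.swap).trace = X.trace := fun X =>
    Fintype.sum_equiv (Equiv.prodComm _ _) _ _ fun _ => rfl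
  have hΦ : maxEntangled (Fin 2) = (maxEntangled (Fin 2)).submatrix Prod.swap Prod.swap := by
    ext ⟨i, j⟩ ⟨i', j'⟩
    simp [maxEntangled_two_apply, eq_comm]
  refine ⟨swapMap L, ⟨hcp.swapMap, ?_⟩, ?_, ?_⟩
  · show IsExtendible k _
    rw [choi_swapMap]
    exact hext
  · exact hpos.trans_eq (congrArg _ (htr _).symm)
  · rw [← hfid, fidelity, fidelity]
    congr 2
    · rw [hΦ]
      show ((L _).submatrix Prod.swap Prod.swap * _).trace = _
      rw [show (Prod.swap : Fin 2 × Fin 2 → Fin 2 × Fin 2) = Equiv.prodComm _ _ from rfl,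
        submatrix_mul_equiv, Equiv.coe_prodComm, htr, ← Equiv.coe_prodComm, Equiv.coe_prodComm,
        ← hΦ]
    · exact htr _

theorem distills_alice {A B : Type*} [Fintype A] [DecidableEq A] [Fintype B] [DecidableEq B]
    (ρ : Matrix (A × B) (A × B) ℂ) (hρ : ρ.PosSemidef)
    (h : ¬ ∃ ω : Matrix B B ℂ, ρ = (1 : Matrix A A ℂ) ⊗ₖ ω) : Distills Site.alice ρ := by
  have hB := distills_bob (ρ.submatrix (Prod.swap : B × A → A × B) Prod.swap) (hρ.submatrix _) (by
    rintro ⟨ω, hω⟩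
    refine h ⟨ω, ?_⟩
    ext ⟨a, b⟩ ⟨a', b'⟩
    have := congrFun (congrFun hω (b, a)) (b', a')
    simp only [submatrix_apply, Prod.swap, kroneckerMap_apply] at this
    rw [this, kroneckerMap_apply, mul_comm])
  intro k α hα
  obtain ⟨N, hN⟩ := hB k α hα
  exact ⟨N, fun n hn F hF hFα => Attains.alice_of_swap (hN n hn F hF hFα)⟩

/-! ### States of both exceptional forms, and the theorem -/

/-- Comparing entries at a fixed `b₀` shows that `ω` is scalar; the trace fixes the scalar. -/
theorem eq_maximallyMixed {A B : Type*} [Fintype A] [DecidableEq A] [Fintype B] [DecidableEq B]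
    {ρ : Matrix (A × B) (A × B) ℂ} (htr : ρ.trace = 1) {ω : Matrix A A ℂ} {τ : Matrix B B ℂ}
    (hA : ρ = ω ⊗ₖ (1 : Matrix B B ℂ)) (hB : ρ = (1 : Matrix A A ℂ) ⊗ₖ τ) :
    ρ = maximallyMixed (A × B) := by
  obtain ⟨a₀, b₀⟩ : Nonempty (A × B) := by
    by_contra hne
    rw [not_nonempty_iff] at hne
    simp [Matrix.trace] at htr
  have hentry := fun a b a' b' => (congrFun (congrFun hA (a, b)) (a', b')).symm.trans
    (congrFun (congrFun hB (a, b)) (a', b'))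
  simp only [kroneckerMap_apply] at hentry
  have hρ : ρ = ω a₀ a₀ • (1 : Matrix (A × B) (A × B) ℂ) := by
    rw [hA, ← one_kronecker_one, ← smul_kronecker]
    congr 1
    ext a a'
    have h1 := hentry a b₀ a' b₀
    have h2 := hentry a₀ b₀ a₀ b₀
    simp at h1 h2
    simp [h1, h2, mul_comm]
  rw [hρ, trace_smul, trace_one, smul_eq_mul] at htr
  rw [hρ, maximallyMixed, eq_inv_of_mul_eq_one_left htr]

end ExtendibleMaps

end

theorem mainTheorem3 {A B : Type*} [Fintype A] [DecidableEq A] [Fintype B] [DecidableEq B]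
    (ρ : Matrix (A × B) (A × B) ℂ) (hρ : ExtendibleMaps.IsState ρ) :
    (ρ ≠ ExtendibleMaps.maximallyMixed (A × B) →
      ∃ s : ExtendibleMaps.Site, ExtendibleMaps.Distills s ρ) ∧
    ((¬ ∃ ω : Matrix A A ℂ, ρ = ω ⊗ₖ (1 : Matrix B B ℂ)) →
      ExtendibleMaps.Distills ExtendibleMaps.Site.bob ρ) ∧
    ((¬ ∃ ω : Matrix B B ℂ, ρ = (1 : Matrix A A ℂ) ⊗ₖ ω) →
      ExtendibleMaps.Distills ExtendibleMaps.Site.alice ρ) := by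
  refine ⟨fun hne => ?_, ExtendibleMaps.distills_bob ρ hρ.1, ExtendibleMaps.distills_alice ρ hρ.1⟩
  by_cases hA : ∃ ω : Matrix A A ℂ, ρ = ω ⊗ₖ (1 : Matrix B B ℂ)
  · refine ⟨_, ExtendibleMaps.distills_alice ρ hρ.1 ?_⟩
    rintro ⟨τ, hτ⟩
    obtain ⟨ω, hω⟩ := hA
    exact hne (ExtendibleMaps.eq_maximallyMixed hρ.2 hω hτ)
  · exact ⟨_, ExtendibleMaps.distills_bob ρ hρ.1 hA⟩
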